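/- Let $d \ge 2$, let $M$ and $N$ be dual lattices of rank $d$ with pairing $\langle\cdot,\cdot\rangle : M\times N\to\mathbb Z$, and let $M_{\mathbb R}=M\otimes\mathbb R$, $N_{\mathbb R}=N\otimes\mathbb R$. A lattice polytope is a polytope whose vertices are lattice points. For a lattice polytope $P$, $\mathrm{Vol}(P)$ is $d!$ times its Euclidean volume with respect to a lattice basis. For full-dimensional lattice polytopes write $P_1\cong P_2$ if they are unimodularly equivalent, i.e. if some affine isomorphism of the ambient spaces that maps lattice onto lattice maps $P_1$ onto $P_2$. A polytope $P\subseteq M_{\mathbb R}$ is reflexive if it is a $d$-dimensional lattice polytope containing the origin in its interior whose dual $P^*=\{x\in N_{\mathbb R} : \langle y,x\rangle\ge -1 \text{ for all } y\in P\}$ is also a lattice polytope. Let $y_0=2$, $y_n=1+y_0\cdots y_{n-1}$ $(n\ge 1)$ be the Sylvester sequence, put $t_n=y_n-1$, and let $Q_d=(t_d/y_0,\dots,t_d/y_{d-1},1)$. For a tuple $Q=(q_0,\dots,q_d)$ of positive integers with $q_d=1$ whose sum $|Q|$ is divisible by every $q_i$, put $k_i=|Q|/q_i$ and $$S_Q=\mathrm{conv}(k_0e_0-u,\dots,k_{d-1}e_{d-1}-u,-u),\qquad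 u=e_0+\dots+e_{d-1},$$ where $e_0,\dots,e_{d-1}$ is a lattice basis. **Theorem C.** Let $P\subseteq M_{\mathbb R}$ be a $d$-dimensional reflexive simplex. Then $$(d+1)^{d+1}\le \mathrm{Vol}(P)\,\mathrm{Vol}(P^*)\le t_d^2,$$ with equality in the first bound if and only if the sum of the vertices of $P$ equals $0$, and equality in the second bound if and only if $P\cong S_{Q_d}$ (in this case $P\cong P^*$). Furthermore, if the vertices of $P^*$ generate the lattice $N$, then $$\mathrm{Vol}(P^*)\le t_d,$$ with equality if and only if $P^*\cong S_{Q_d}\cong P$. -/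

import Mathlib

/-- The lattice `ℤ^d` inside `ℝ^d`. It serves both as the lattice `M ⊆ M_ℝ` (in coordinates with
respect to a lattice basis) and as the dual lattice `N ⊆ N_ℝ` (in coordinates with respect to the
dual basis); the pairing between `M_ℝ` and `N_ℝ` is then the dot product. -/
def intLattice (d : ℕ) : AddSubgroup (Fin d → ℝ) where
  carrier := {x | ∀ i, ∃ n : ℤ, x i = (n : ℝ)}
  zero_mem' := fun _ => ⟨0, by simp⟩
  add_mem' := fun {a b} ha hb i => by
    obtain ⟨m, hm⟩ := ha i
    obtain ⟨n, hn⟩ := hb i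
    exact ⟨m + n, by simp [hm, hn]⟩
  neg_mem' := fun {a} ha i => by
    obtain ⟨m, hm⟩ := ha i
    exact ⟨-m, by simp [hm]⟩

/-- A lattice polytope: the convex hull of finitely many points, all of whose vertices
(extreme points) are lattice points. -/
def IsLatticePolytope {d : ℕ} (P : Set (Fin d → ℝ)) : Prop :=
  (∃ s : Set (Fin d → ℝ), s.Finite ∧ P = convexHull ℝ s) ∧
    P.extremePoints ℝ ⊆ (intLattice d : Set (Fin d → ℝ))

/-- The dual `P* = {x | ⟨y, x⟩ ≥ -1 for all y ∈ P}`. -/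
def polytopeDual {d : ℕ} (P : Set (Fin d → ℝ)) : Set (Fin d → ℝ) :=
  {x | ∀ y ∈ P, -1 ≤ y ⬝ᵥ x}

/-- A reflexive polytope: a lattice polytope with the origin in its interior (so that it is
`d`-dimensional) whose dual is a lattice polytope as well. -/
def IsReflexivePolytope {d : ℕ} (P : Set (Fin d → ℝ)) : Prop :=
  IsLatticePolytope P ∧ 0 ∈ interior P ∧ IsLatticePolytope (polytopeDual P)

/-- The normalized volume: `d!` times the Lebesgue measure. -/
noncomputable def normalizedVol {d : ℕ} (P : Set (Fin d → ℝ)) : ℝ :=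
  (d.factorial : ℝ) * (MeasureTheory.volume P).toReal

/-- Unimodular equivalence: some affine bijection that maps the lattice onto the lattice maps
`P₁` onto `P₂` (and then automatically `i`-dimensional faces onto `i`-dimensional faces). -/
def UnimodularEquiv {d : ℕ} (P₁ P₂ : Set (Fin d → ℝ)) : Prop :=
  ∃ φ : (Fin d → ℝ) ≃ᵃ[ℝ] (Fin d → ℝ),
    φ '' (intLattice d : Set (Fin d → ℝ)) = (intLattice d : Set (Fin d → ℝ)) ∧ φ '' P₁ = P₂

/-- The Sylvester sequence `y_n = 1 + y_0 ⋯ y_{n-1}`, that is `2, 3, 7, 43, …`;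
for `n = 0` the product is empty, so `y_0 = 1 + 1 = 2`. -/
def sylvesterY (n : ℕ) : ℕ :=
  1 + ∏ i : Fin n, sylvesterY i.val
termination_by n
decreasing_by exact i.isLt

/-- `t_n = y_n - 1`. -/
def sylvesterT (n : ℕ) : ℕ := sylvesterY n - 1

/-- The Sylvester weight system `Q_d = (t_d / y_0, …, t_d / y_{d-1}, 1)`; for `i < d` the number
`y_i` divides `t_d = y_0 ⋯ y_{d-1}`. -/
def sylvesterWeights (d : ℕ) : Fin (d + 1) → ℕ :=
  Fin.snoc (α := fun _ => ℕ) (fun i : Fin d => sylvesterT d / sylvesterY i.val) 1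

/-- The simplex `S_Q = conv(k_0 e_0 - u, …, k_{d-1} e_{d-1} - u, -u)` with `k_i = |Q| / q_i` and
`u = e_0 + ⋯ + e_{d-1}`, for the standard basis `e_0, …, e_{d-1}`. -/
noncomputable def weightSimplex {d : ℕ} (Q : Fin (d + 1) → ℕ) : Set (Fin d → ℝ) :=
  convexHull ℝ (insert (fun _ => -1) (Set.range fun i : Fin d =>
    fun j => (if j = i then ((∑ l, Q l : ℕ) : ℝ) / (Q i.castSucc : ℝ) else 0) - 1))

/-! Let `v i` be the vertices of `P`, `w j` those of `P*`, and `1 / c i` the barycentric coordinates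
of the origin. Then `v i ⬝ᵥ w j` is `c i - 1` for `i = j` and `-1` otherwise. Reflexivity makes
these pairings integers, so the `c i` are positive integers `k i` with `∑ 1 / k i = 1`. The
determinant of the pairing matrix gives `Vol(P) Vol(P*) = ∏ k i` (`normalizedVol_mul`), and both
bounds become statements about partitions of 1 into unit fractions.

The lower bound is AM-GM. For the upper bound, sort `k`: clearing denominators gives `∏ 1 / k i ≤ 1
- ∑ 1 / k i` over each proper initial segment, with equality for Sylvester numbers. A majorization
argument (`eq_of_prod_le_of_prod_le_tail`) then leaves only the Sylvester partition with product at
least `t_d ^ 2`. For that partition the two integral vertex determinants multiply to 1, so both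
simplices are equivalent to `S_{Q_d}`.

If the `w i` generate the lattice, the linear map `w i ↦ v i` is integral, whence `Vol(P*) ≤ Vol(P)`
and `Vol(P*) ^ 2 ≤ t_d ^ 2`. -/

/-! ### Majorization for products of decreasing sequences -/

/-- Abel summation: the difference of the two sides is a sum of drops of `x` times partial sums of
`l`. -/
theorem mul_sum_le_sum_mul_of_antitone {x l : ℕ → ℝ} (n : ℕ)
    (hx : ∀ i, i < n → x (i + 1) ≤ x i)
    (hl : ∀ m ≤ n, 0 ≤ ∑ i ∈ Finset.range m, l i) :
    x n * ∑ i ∈ Finset.range (n + 1), l i ≤ ∑ i ∈ Finset.range (n + 1), x i * l i := by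
  induction n with
  | zero => simp
  | succ n ih =>
    have h1 := ih (fun i hi => hx i (by omega)) (fun m hm => hl m (by omega))
    rw [Finset.sum_range_succ _ (n + 1), Finset.sum_range_succ _ (n + 1), mul_add]
    have h2 := mul_le_mul_of_nonneg_right (hx n (by omega)) (hl (n + 1) le_rfl)
    linarith

/-- If the partial products of the decreasing sequence `x` are dominated by those of `a`,
then the sum of `x` is strictly smaller than the sum of `a`, unless the sequences agree. -/
theorem eq_of_prod_le_prod_of_sum_le_sum {x a : ℕ → ℝ} (n : ℕ)
    (hx0 : ∀ i < n, 0 < x i) (ha0 : ∀ i < n, 0 < a i)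
    (hx : ∀ i, i + 1 < n → x (i + 1) ≤ x i)
    (hprod : ∀ m ≤ n, ∏ i ∈ Finset.range m, x i ≤ ∏ i ∈ Finset.range m, a i)
    (hsum : ∑ i ∈ Finset.range n, a i ≤ ∑ i ∈ Finset.range n, x i) :
    ∀ i < n, x i = a i := by
  rcases n with _ | n
  · simp
  have hlog : ∀ m ≤ n + 1, 0 ≤ ∑ i ∈ Finset.range m, Real.log (a i / x i) := by
    intro m hm
    rw [← Real.log_prod (fun i hi => ne_of_gt (div_pos (ha0 i (by grind)) (hx0 i (by grind)))),
      Finset.prod_div_distrib]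
    apply Real.log_nonneg
    rw [one_le_div (Finset.prod_pos fun i hi => hx0 i (by grind))]
    exact hprod m hm
  have habel := mul_sum_le_sum_mul_of_antitone (x := x) (l := fun i => Real.log (a i / x i)) n
    (fun i hi => hx i (by omega)) (fun m hm => hlog m (by omega))
  have hnonneg : 0 ≤ ∑ i ∈ Finset.range (n + 1), x i * Real.log (a i / x i) :=
    le_trans (mul_nonneg (hx0 n (by omega)).le (hlog (n + 1) le_rfl)) habel
  -- The chain `0 ≤ ∑ x log (a / x) ≤ ∑ (a - x) ≤ 0` forces equality in every `log t ≤ t - 1`, hence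
  -- `t = 1`.
  have hterm : ∀ i ∈ Finset.range (n + 1), x i * Real.log (a i / x i) ≤ a i - x i := by
    intro i hi
    have h1 := hx0 i (by grind)
    have h2 := Real.log_le_sub_one_of_pos (div_pos (ha0 i (by grind)) h1)
    calc x i * Real.log (a i / x i) ≤ x i * (a i / x i - 1) := by gcongr
      _ = a i - x i := by field_simp
  have heq : ∑ i ∈ Finset.range (n + 1), x i * Real.log (a i / x i)
      = ∑ i ∈ Finset.range (n + 1), (a i - x i) := by
    apply le_antisymm (Finset.sum_le_sum hterm)
    rw [Finset.sum_sub_distrib]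
    linarith
  intro i hi
  by_contra hne
  have h1 := hx0 i hi
  have h2 : a i / x i ≠ 1 := fun h => hne ((div_eq_one_iff_eq h1.ne').mp h).symm
  have h3 := (Finset.sum_eq_sum_iff_of_le hterm).mp heq i (by simpa using hi)
  have h4 := Real.log_lt_sub_one_of_pos (div_pos (ha0 i hi) h1) h2
  have h5 : x i * Real.log (a i / x i) < x i * (a i / x i - 1) := by gcongr
  have h6 : x i * (a i / x i - 1) = a i - x i := by field_simp
  linarith

/-- Among the decreasing positive sequences of sum `s` whose partial products are at most the
remaining sums, a sequence `a` with equality throughout has the smallest product. -/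
theorem eq_of_prod_le_of_prod_le_tail {x a : ℕ → ℝ} {s : ℝ} (n : ℕ)
    (hx0 : ∀ i < n, 0 < x i) (ha0 : ∀ i < n, 0 < a i)
    (hx : ∀ i, i + 1 < n → x (i + 1) ≤ x i)
    (hxs : ∑ i ∈ Finset.range n, x i = ∑ i ∈ Finset.range n, a i)
    (hxt : ∀ j < n, ∏ i ∈ Finset.range j, x i ≤ s - ∑ i ∈ Finset.range j, x i)
    (hat : ∀ j < n, ∏ i ∈ Finset.range j, a i = s - ∑ i ∈ Finset.range j, a i)
    (hprod : ∏ i ∈ Finset.range n, x i ≤ ∏ i ∈ Finset.range n, a i) :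
    ∀ i < n, x i = a i := by
  induction n using Nat.strong_induction_on with
  | _ n ih =>
  classical
  rcases Nat.eq_zero_or_pos n with rfl | hn
  · simp
  -- Cut at the last `j < n` where the partial product of `x` is not below that of `a`. Beyond `j`
  -- the tail products of `x` are dominated, while `hxt` and `hat` at `j` make its tail sum at least
  -- that of `a`. So the tails agree, and cancelling them leaves the same problem of length `j`.
  obtain ⟨j, hjn, hpj, hgt⟩ : ∃ j < n, ∏ i ∈ Finset.range j, a i ≤ ∏ i ∈ Finset.range j, x i ∧
      ∀ m, j < m → m < n → ∏ i ∈ Finset.range m, x i < ∏ i ∈ Finset.range m, a i := by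
    set p : ℕ → Prop := fun j => ∏ i ∈ Finset.range j, a i ≤ ∏ i ∈ Finset.range j, x i with hp
    refine ⟨Nat.findGreatest p (n - 1), ?_, ?_, fun m h1 h2 => ?_⟩
    · have := Nat.findGreatest_le (P := p) (n - 1)
      omega
    · exact Nat.findGreatest_spec (P := p) (m := 0) (Nat.zero_le _) (by simp [hp])
    · exact not_le.mp (Nat.findGreatest_is_greatest (P := p) h1 (by omega))
  have hle : ∀ m, j < m → m ≤ n → ∏ i ∈ Finset.range m, x i ≤ ∏ i ∈ Finset.range m, a i := by
    intro m h1 h2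
    rcases h2.lt_or_eq with h2 | rfl
    · exact (hgt m h1 h2).le
    · exact hprod
  obtain ⟨r, rfl⟩ : ∃ r, n = j + r := ⟨n - j, by omega⟩
  have htail : ∀ i < r, x (j + i) = a (j + i) := by
    refine eq_of_prod_le_prod_of_sum_le_sum (x := fun i => x (j + i)) (a := fun i => a (j + i)) r
      (fun i hi => hx0 _ (by omega)) (fun i hi => ha0 _ (by omega))
      (fun i hi => hx (j + i) (by omega)) ?_ ?_
    · intro m hm
      rcases Nat.eq_zero_or_pos m with rfl | hm0
      · simp
      have h1 := hle (j + m) (by omega) (by omega)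
      rw [Finset.prod_range_add, Finset.prod_range_add] at h1
      have h2 : 0 < ∏ i ∈ Finset.range j, a i := Finset.prod_pos fun i hi => ha0 i (by grind)
      have h3 : 0 ≤ ∏ i ∈ Finset.range m, x (j + i) :=
        Finset.prod_nonneg fun i hi => (hx0 (j + i) (by grind)).le
      have h4 := mul_le_mul_of_nonneg_right hpj h3
      exact le_of_mul_le_mul_left (h4.trans h1) h2
    · have h1 := hxt j (by omega)
      have h2 := hat j (by omega)
      have h3 : ∏ i ∈ Finset.range j, a i ≤ ∏ i ∈ Finset.range j, x i := hpj
      rw [Finset.sum_range_add, Finset.sum_range_add] at hxs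
      linarith
  have hhead : ∀ i < j, x i = a i := by
    refine ih j (by omega) (fun i hi => hx0 _ (by omega)) (fun i hi => ha0 _ (by omega))
      (fun i hi => hx i (by omega)) ?_ (fun i hi => hxt i (by omega))
      (fun i hi => hat i (by omega)) ?_
    · rw [Finset.sum_range_add, Finset.sum_range_add,
        Finset.sum_congr rfl fun i hi => htail i (by simpa using hi)] at hxs
      linarith
    · rw [Finset.prod_range_add, Finset.prod_range_add,
        Finset.prod_congr rfl fun i hi => htail i (by simpa using hi)] at hprod
      exact le_of_mul_le_mul_right hprod (Finset.prod_pos fun i hi => ha0 (j + i) (by grind))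
  intro i hi
  rcases lt_or_ge i j with h | h
  · exact hhead i h
  · obtain ⟨q, rfl⟩ := Nat.exists_eq_add_of_le h
    exact htail q (by omega)

/-! ### The Sylvester sequence -/

theorem sylvesterY_eq (n : ℕ) :
    sylvesterY n = 1 + ∏ i ∈ Finset.range n, sylvesterY i := by
  rw [sylvesterY, Fin.prod_univ_eq_prod_range]

theorem sylvesterT_eq (n : ℕ) : sylvesterT n = ∏ i ∈ Finset.range n, sylvesterY i := by
  rw [sylvesterT, sylvesterY_eq]; omega

theorem sylvesterY_pos (n : ℕ) : 0 < sylvesterY n := by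
  rw [sylvesterY_eq]; omega

theorem sylvesterT_pos (n : ℕ) : 0 < sylvesterT n := by
  rw [sylvesterT_eq]; exact Finset.prod_pos fun i _ => sylvesterY_pos i

theorem sylvesterY_dvd_sylvesterT {i n : ℕ} (h : i < n) : sylvesterY i ∣ sylvesterT n := by
  rw [sylvesterT_eq]
  exact Finset.dvd_prod_of_mem _ (by simpa using h)

/-- Telescoping: `t_{n+1} = t_n (t_n + 1)` gives `1 / y_n = 1 / t_n - 1 / t_{n+1}`. -/
theorem sum_inv_sylvesterY (n : ℕ) :
    ∑ i ∈ Finset.range n, (sylvesterY i : ℝ)⁻¹ = 1 - (sylvesterT n : ℝ)⁻¹ := by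
  induction n with
  | zero => simp [sylvesterT_eq]
  | succ n ih =>
    have h1 : (sylvesterY n : ℝ) = sylvesterT n + 1 := by
      rw [sylvesterY_eq, ← sylvesterT_eq]; push_cast; ring
    have h2 : (sylvesterT (n + 1) : ℝ) = sylvesterT n * sylvesterY n := by
      rw [sylvesterT_eq, Finset.prod_range_succ, ← sylvesterT_eq]; push_cast; rfl
    have h3 : (0 : ℝ) < sylvesterT n := by exact_mod_cast sylvesterT_pos n
    rw [Finset.sum_range_succ, ih, h2, h1]
    field_simp
    ring

/-- The denominators `y_0, …, y_{d-1}, t_d` of the Sylvester partition of `1`. -/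
def sylvesterPartition (d : ℕ) : Fin (d + 1) → ℕ :=
  Fin.snoc (α := fun _ => ℕ) (fun i : Fin d => sylvesterY i.val) (sylvesterT d)

@[simp] theorem sylvesterPartition_castSucc {d : ℕ} (i : Fin d) :
    sylvesterPartition d i.castSucc = sylvesterY i := by
  simp [sylvesterPartition]

@[simp] theorem sylvesterPartition_last (d : ℕ) :
    sylvesterPartition d (Fin.last d) = sylvesterT d := by
  simp [sylvesterPartition]

theorem sylvesterPartition_pos {d : ℕ} (i : Fin (d + 1)) : 0 < sylvesterPartition d i := by
  induction i using Fin.lastCases with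
  | last => simpa using sylvesterT_pos d
  | cast i => simpa using sylvesterY_pos i

theorem prod_sylvesterPartition_castSucc (d : ℕ) :
    ∏ i : Fin d, (sylvesterPartition d i.castSucc : ℝ) = sylvesterT d := by
  simp only [sylvesterPartition_castSucc]
  rw [Fin.prod_univ_eq_prod_range (fun i => (sylvesterY i : ℝ)), sylvesterT_eq]
  push_cast
  rfl

theorem prod_sylvesterPartition (d : ℕ) : ∏ i, sylvesterPartition d i = sylvesterT d ^ 2 := by
  rw [Fin.prod_univ_castSucc]
  simp only [sylvesterPartition_castSucc, sylvesterPartition_last]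
  rw [Fin.prod_univ_eq_prod_range, ← sylvesterT_eq, sq]

theorem sum_inv_sylvesterPartition (d : ℕ) : ∑ i, (sylvesterPartition d i : ℝ)⁻¹ = 1 := by
  rw [Fin.sum_univ_castSucc]
  simp only [sylvesterPartition_castSucc, sylvesterPartition_last]
  rw [Fin.sum_univ_eq_sum_range (fun i => (sylvesterY i : ℝ)⁻¹), sum_inv_sylvesterY]
  ring

/-! ### Partitions of 1 into unit fractions -/

theorem exists_int_prod_mul_sum_inv {k : ℕ → ℕ} (hk : ∀ i, 0 < k i) (n : ℕ) :
    ∃ z : ℤ, (∏ i ∈ Finset.range n, (k i : ℝ)) * ∑ i ∈ Finset.range n, (k i : ℝ)⁻¹ = z := by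
  induction n with
  | zero => exact ⟨0, by simp⟩
  | succ n ih =>
    obtain ⟨z, hz⟩ := ih
    have : (k n : ℝ) ≠ 0 := by exact_mod_cast (hk n).ne'
    refine ⟨z * k n + ∏ i ∈ Finset.range n, (k i : ℤ), ?_⟩
    rw [Finset.prod_range_succ, Finset.sum_range_succ]
    push_cast
    rw [← hz]
    field_simp

/-- The right side is a positive rational whose denominator divides `∏ k i`. -/
theorem prod_inv_le_one_sub_sum_inv {k : ℕ → ℕ} (hk : ∀ i, 0 < k i) (n : ℕ)
    (h : ∑ i ∈ Finset.range n, (k i : ℝ)⁻¹ < 1) :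
    ∏ i ∈ Finset.range n, (k i : ℝ)⁻¹ ≤ 1 - ∑ i ∈ Finset.range n, (k i : ℝ)⁻¹ := by
  obtain ⟨z, hz⟩ := exists_int_prod_mul_sum_inv hk n
  have hK : 0 < ∏ i ∈ Finset.range n, (k i : ℝ) :=
    Finset.prod_pos fun i _ => by exact_mod_cast hk i
  have h1 : (z : ℝ) < (∏ i ∈ Finset.range n, (k i : ℤ) : ℤ) := by
    push_cast
    rw [← hz]
    nlinarith
  have h2 : z + 1 ≤ ∏ i ∈ Finset.range n, (k i : ℤ) := by exact_mod_cast h1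
  have h3 : (z : ℝ) + 1 ≤ ∏ i ∈ Finset.range n, (k i : ℝ) := by exact_mod_cast h2
  rw [Finset.prod_inv_distrib, inv_le_iff_one_le_mul₀ hK]
  nlinarith

/-- A nondecreasing unit partition with product at least `t_d ^ 2` is the Sylvester partition. -/
theorem eq_sylvesterPartition_of_monotone {d : ℕ} {k : Fin (d + 1) → ℕ} (hk : ∀ i, 0 < k i)
    (hmono : Monotone k) (hsum : ∑ i, (k i : ℝ)⁻¹ = 1) (hprod : sylvesterT d ^ 2 ≤ ∏ i, k i) :
    k = sylvesterPartition d := by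
  -- The value 1 outside the range only keeps the extended sequences positive.
  set K : ℕ → ℕ := fun i => if h : i < d + 1 then k ⟨i, h⟩ else 1 with hK
  set A : ℕ → ℕ := fun i => if h : i < d + 1 then sylvesterPartition d ⟨i, h⟩ else 1 with hA
  have hKf : ∀ i : Fin (d + 1), K i = k i := fun i => by simp only [hK, i.isLt, dif_pos]
  have hAf : ∀ i : Fin (d + 1), A i = sylvesterPartition d i := fun i => by simp only [hA, i.isLt, dif_pos]
  have hK0 : ∀ i, 0 < K i := fun i => by
    simp only [hK]; split_ifs with h
    exacts [hk _, one_pos]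
  have hA0 : ∀ i, 0 < A i := fun i => by
    simp only [hA]; split_ifs with h
    exacts [sylvesterPartition_pos _, one_pos]
  have hAy : ∀ i < d, A i = sylvesterY i := fun i hi => by
    exact (hAf (Fin.castSucc ⟨i, hi⟩)).trans (sylvesterPartition_castSucc _)
  have hKs : ∑ i ∈ Finset.range (d + 1), (K i : ℝ)⁻¹ = 1 := by
    rw [← Fin.sum_univ_eq_sum_range (fun i => (K i : ℝ)⁻¹), ← hsum]
    simp only [hKf]
  have hAs : ∑ i ∈ Finset.range (d + 1), (A i : ℝ)⁻¹ = 1 := by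
    rw [← Fin.sum_univ_eq_sum_range (fun i => (A i : ℝ)⁻¹), ← sum_inv_sylvesterPartition d]
    simp only [hAf]
  have hmain := eq_of_prod_le_of_prod_le_tail (x := fun i => (K i : ℝ)⁻¹)
    (a := fun i => (A i : ℝ)⁻¹) (s := 1) (d + 1)
    (fun i _ => inv_pos.mpr (by exact_mod_cast hK0 i))
    (fun i _ => inv_pos.mpr (by exact_mod_cast hA0 i)) ?_ (hKs.trans hAs.symm) ?_ ?_ ?_
  · funext i
    have := hmain i i.isLt
    rw [hKf, hAf] at this
    exact_mod_cast inv_injective this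
  · intro i hi
    apply inv_anti₀ (by exact_mod_cast hK0 i)
    have := hmono (a := ⟨i, by omega⟩) (b := ⟨i + 1, hi⟩) (by simp)
    simp only [hK, hi, show i < d + 1 by omega, dif_pos]
    exact_mod_cast this
  · intro j hj
    apply prod_inv_le_one_sub_sum_inv hK0
    rw [← hKs]
    exact Finset.sum_lt_sum_of_subset (i := j) (by grind) (by simpa using hj) (by simp)
      (inv_pos.mpr (by exact_mod_cast hK0 j)) (fun i _ _ => by positivity)
  -- As `j ≤ d`, only `y_0, …, y_{j-1}` enter, and both sides equal `1 / t_j`.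
  · intro j hj
    have h1 : ∀ i ∈ Finset.range j, (A i : ℝ)⁻¹ = (sylvesterY i : ℝ)⁻¹ := fun i hi => by
      rw [hAy i (by grind)]
    rw [Finset.prod_congr rfl h1, Finset.sum_congr rfl h1, sum_inv_sylvesterY,
      Finset.prod_inv_distrib, sylvesterT_eq]
    push_cast
    ring
  · rw [Finset.prod_inv_distrib, Finset.prod_inv_distrib,
      ← Fin.prod_univ_eq_prod_range (fun i => (K i : ℝ)),
      ← Fin.prod_univ_eq_prod_range (fun i => (A i : ℝ))]
    simp only [hKf, hAf]
    apply inv_anti₀ (Finset.prod_pos fun i _ => by exact_mod_cast sylvesterPartition_pos i)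
    rw [← prod_sylvesterPartition] at hprod
    exact_mod_cast hprod

theorem exists_perm_eq_sylvesterPartition {d : ℕ} {k : Fin (d + 1) → ℕ} (hk : ∀ i, 0 < k i)
    (hsum : ∑ i, (k i : ℝ)⁻¹ = 1) (hprod : sylvesterT d ^ 2 ≤ ∏ i, k i) :
    ∃ σ : Equiv.Perm (Fin (d + 1)), k ∘ σ = sylvesterPartition d := by
  refine ⟨Tuple.sort k, eq_sylvesterPartition_of_monotone (fun i => hk _)
    (Tuple.monotone_sort k) ?_ ?_⟩
  · rw [← hsum]
    exact Equiv.sum_comp (Tuple.sort k) (fun i => (k i : ℝ)⁻¹)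
  · exact hprod.trans_eq (Equiv.prod_comp (Tuple.sort k) k).symm

/-- The product of the denominators of a partition of `1` into `d + 1` unit fractions is at most
`t_d ^ 2`. -/
theorem prod_le_sylvesterT_sq {d : ℕ} {k : Fin (d + 1) → ℕ} (hk : ∀ i, 0 < k i)
    (hsum : ∑ i, (k i : ℝ)⁻¹ = 1) : ∏ i, k i ≤ sylvesterT d ^ 2 := by
  by_contra! h
  obtain ⟨σ, hσ⟩ := exists_perm_eq_sylvesterPartition hk hsum h.le
  have : ∏ i, k i = sylvesterT d ^ 2 := by
    rw [← prod_sylvesterPartition, ← hσ]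
    exact (Equiv.prod_comp σ k).symm
  omega

/-- AM-GM with its equality case: sum `log t ≤ t - 1` over `t = (d + 1) / k i`, where the right
sides add up to 0. -/
theorem pow_le_prod_of_sum_inv_eq_one {d : ℕ} {k : Fin (d + 1) → ℕ} (hk : ∀ i, 0 < k i)
    (hsum : ∑ i, (k i : ℝ)⁻¹ = 1) :
    ((d : ℝ) + 1) ^ (d + 1) ≤ ∏ i, (k i : ℝ) ∧
      (∏ i, (k i : ℝ) = ((d : ℝ) + 1) ^ (d + 1) ↔ ∀ i, (k i : ℝ) = d + 1) := by
  have hk' : ∀ i, (0 : ℝ) < k i := fun i => by exact_mod_cast hk i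
  have hd : (0 : ℝ) < d + 1 := by positivity
  have hlog : ∀ i ∈ Finset.univ,
      Real.log ((d + 1) * (k i : ℝ)⁻¹) ≤ (d + 1) * (k i : ℝ)⁻¹ - 1 :=
    fun i _ => Real.log_le_sub_one_of_pos (mul_pos hd (inv_pos.mpr (hk' i)))
  have hz : ∑ i, (((d : ℝ) + 1) * (k i : ℝ)⁻¹ - 1) = 0 := by
    rw [Finset.sum_sub_distrib, ← Finset.mul_sum, hsum]
    simp
  have hl : ∑ i, Real.log (((d : ℝ) + 1) * (k i : ℝ)⁻¹)
      = (d + 1) * Real.log (d + 1) - Real.log (∏ i, (k i : ℝ)) := by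
    rw [Real.log_prod (fun i _ => (hk' i).ne')]
    simp_rw [Real.log_mul hd.ne' (inv_ne_zero (hk' _).ne'), Real.log_inv]
    rw [Finset.sum_add_distrib, Finset.sum_neg_distrib]
    simp
    ring
  have hprod : 0 < ∏ i, (k i : ℝ) := Finset.prod_pos fun i _ => hk' i
  have hpl : Real.log (((d : ℝ) + 1) ^ (d + 1)) = (d + 1) * Real.log (d + 1) := by
    rw [Real.log_pow]; push_cast; ring
  refine ⟨?_, ?_, ?_⟩
  · rw [← Real.log_le_log_iff (by positivity) hprod, hpl]
    have := Finset.sum_le_sum hlog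
    linarith
  · intro h i
    have h1 := (Finset.sum_eq_sum_iff_of_le hlog).mp (by rw [hz, hl, h, hpl]; ring) i
      (Finset.mem_univ i)
    by_contra hne
    refine (Real.log_lt_sub_one_of_pos (mul_pos hd (inv_pos.mpr (hk' i))) ?_).ne h1
    rw [← div_eq_mul_inv]
    intro h2
    exact hne ((div_eq_one_iff_eq (hk' i).ne').mp h2).symm
  · intro h
    rw [Finset.prod_congr rfl fun i _ => h i]
    simp

/-! ### Volumes and determinants of simplices -/

theorem volume_corner_simplex (n : ℕ) {t : ℝ} (ht : 0 ≤ t) :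
    MeasureTheory.volume {x : Fin n → ℝ | (∀ i, 0 ≤ x i) ∧ ∑ i, x i ≤ t}
      = ENNReal.ofReal (t ^ n / n.factorial) := by
  induction n generalizing t with
  | zero => simp [ht, MeasureTheory.Measure.volume_pi_eq_dirac 0]
  | succ n ih =>
    set e := MeasurableEquiv.piFinSuccAbove (fun _ : Fin (n + 1) => ℝ) 0 with he
    set B : Set (ℝ × (Fin n → ℝ)) :=
      {p | (0 ≤ p.1 ∧ ∀ i, 0 ≤ p.2 i) ∧ p.1 + ∑ i, p.2 i ≤ t} with hB
    have hBm : MeasurableSet B := by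
      apply IsClosed.measurableSet
      simp only [hB, Set.ofPred_and, Set.ofPred_forall]
      refine IsClosed.inter (IsClosed.inter ?_ (isClosed_iInter fun i => ?_)) ?_ <;>
        exact isClosed_le (by fun_prop) (by fun_prop)
    have hpre : {x : Fin (n + 1) → ℝ | (∀ i, 0 ≤ x i) ∧ ∑ i, x i ≤ t} = e ⁻¹' B := by
      ext x
      simp [hB, he, MeasurableEquiv.piFinSuccAbove, Fin.sum_univ_succ, Fin.forall_fin_succ,
        Fin.tail]
    rw [hpre, (MeasureTheory.volume_preserving_piFinSuccAbove (fun _ : Fin (n + 1) => ℝ)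
      0).measure_preimage hBm.nullMeasurableSet, MeasureTheory.Measure.volume_eq_prod,
      MeasureTheory.Measure.prod_apply hBm]
    -- The slice at first coordinate `s` is a corner simplex of size `t - s`.
    have hslice : ∀ s : ℝ, MeasureTheory.volume (Prod.mk s ⁻¹' B)
        = (Set.Icc 0 t).indicator (fun s => ENNReal.ofReal ((t - s) ^ n / n.factorial)) s := by
      intro s
      by_cases hs : s ∈ Set.Icc 0 t
      · rw [Set.indicator_of_mem hs, ← ih (sub_nonneg.mpr hs.2)]
        congr 1
        ext x
        simp [hB, hs.1, le_sub_iff_add_le']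
      · rw [Set.indicator_of_notMem hs]
        convert MeasureTheory.measure_empty (μ := MeasureTheory.volume)
        ext x
        simp only [hB, Set.mem_preimage, Set.mem_ofPred_eq, Set.mem_empty_iff_false, iff_false]
        rintro ⟨⟨h1, h2⟩, h3⟩
        have : 0 ≤ ∑ i, x i := Finset.sum_nonneg fun i _ => h2 i
        exact hs ⟨h1, by linarith⟩
    simp_rw [hslice]
    rw [MeasureTheory.lintegral_indicator measurableSet_Icc,
      ← MeasureTheory.ofReal_integral_eq_lintegral_ofReal]
    · congr 1
      rw [MeasureTheory.integral_Icc_eq_integral_Ioc, ← intervalIntegral.integral_of_le ht,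
        intervalIntegral.integral_div, intervalIntegral.integral_comp_sub_left (fun x => x ^ n)]
      simp [Nat.factorial_succ]
      field_simp
    · exact (Continuous.integrableOn_Icc (by fun_prop))
    · refine (MeasureTheory.ae_restrict_iff' measurableSet_Icc).mpr (.of_forall fun s hs => ?_)
      have : 0 ≤ t - s := sub_nonneg.mpr hs.2
      positivity

theorem mem_convexHull_range_iff {ι E : Type*} [Fintype ι] [AddCommGroup E] [Module ℝ E]
    {u : ι → E} {x : E} : x ∈ convexHull ℝ (Set.range u) ↔
      ∃ μ : ι → ℝ, (∀ i, 0 ≤ μ i) ∧ ∑ i, μ i = 1 ∧ ∑ i, μ i • u i = x := by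
  classical
  have h : Set.range u = Fintype.linearCombination ℝ u '' Set.range fun i => Pi.single i 1 := by
    rw [← Set.range_comp]
    congr 1
    funext i
    simp
  rw [h, ← LinearMap.image_convexHull, convexHull_rangle_single_eq_stdSimplex]
  simp only [stdSimplex, Set.mem_image, Set.mem_ofPred_eq, Fintype.linearCombination_apply,
    and_assoc]

/-- The square matrix formed by the first `d` vertices. -/
def vertexMatrix {d : ℕ} (u : Fin (d + 1) → Fin d → ℝ) : Matrix (Fin d) (Fin d) ℝ :=
  Matrix.of fun i => u i.castSucc

/-- The simplex is a translated linear image of the corner simplex, under the edge vectors at the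
last vertex; no independence is needed. -/
theorem normalizedVol_convexHull {d : ℕ} (u : Fin (d + 1) → Fin d → ℝ) :
    normalizedVol (convexHull ℝ (Set.range u))
      = |(Matrix.of fun i j : Fin d => u i.castSucc j - u (Fin.last d) j).det| := by
  set N : Matrix (Fin d) (Fin d) ℝ := Matrix.of fun i j => u i.castSucc j - u (Fin.last d) j
    with hN
  set C : Set (Fin d → ℝ) := {x | (∀ i, 0 ≤ x i) ∧ ∑ i, x i ≤ 1} with hC
  have himage : convexHull ℝ (Set.range u)
      = (fun x => u (Fin.last d) + x) '' (Matrix.toLin' N.transpose '' C) := by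
    rw [← Set.image_comp]
    ext x
    rw [mem_convexHull_range_iff]
    have key : ∀ c : Fin d → ℝ, u (Fin.last d) + Matrix.toLin' N.transpose c
        = ∑ i : Fin d, c i • u i.castSucc + (1 - ∑ i, c i) • u (Fin.last d) := by
      intro c
      ext j
      simp [Matrix.mulVec, dotProduct, hN, sub_mul, Finset.sum_sub_distrib,
        ← Finset.mul_sum]
      simp only [mul_comm (c _)]
      ring
    constructor
    · rintro ⟨μ, h0, h1, rfl⟩
      rw [Fin.sum_univ_castSucc] at h1 ⊢
      refine ⟨fun i => μ i.castSucc, ⟨fun i => h0 _, ?_⟩, ?_⟩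
      · have := h0 (Fin.last d)
        linarith
      · simp only [Function.comp_apply]
        rw [key, ← h1]
        simp
    · rintro ⟨c, ⟨h0, h1⟩, rfl⟩
      refine ⟨Fin.snoc (α := fun _ => ℝ) c (1 - ∑ i, c i), fun i => ?_, ?_, ?_⟩
      · induction i using Fin.lastCases with
        | last => simpa using h1
        | cast i => simpa using h0 i
      · rw [Fin.sum_univ_castSucc]; simp
      · simp only [Function.comp_apply]
        rw [Fin.sum_univ_castSucc, key]; simp
  have hvol := volume_corner_simplex d zero_le_one
  rw [normalizedVol, himage, Set.image_add_left, MeasureTheory.measure_preimage_add,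
    MeasureTheory.Measure.addHaar_image_linearMap, hvol, LinearMap.det_toLin',
    Matrix.det_transpose, ENNReal.toReal_mul, ENNReal.toReal_ofReal (abs_nonneg _),
    ENNReal.toReal_ofReal (by positivity)]
  field_simp
  simp

/-- The normalized volume of a simplex with barycentre of the origin given by `k`. -/
theorem normalizedVol_eq_mul_abs_det {d : ℕ} {u : Fin (d + 1) → Fin d → ℝ}
    {k : Fin (d + 1) → ℝ} (hk : ∀ i, 0 < k i) (hsum : ∑ i, (k i)⁻¹ = 1)
    (hu : ∑ i, (k i)⁻¹ • u i = 0) :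
    normalizedVol (convexHull ℝ (Set.range u))
      = k (Fin.last d) * |(vertexMatrix u).det| := by
  rw [normalizedVol_convexHull]
  have hl : k (Fin.last d) ≠ 0 := (hk _).ne'
  rw [Fin.sum_univ_castSucc] at hsum hu
  -- Solving `hu` for the last vertex makes the edge matrix a rank-one update of the identity times
  -- `vertexMatrix u`; the update has determinant `k (Fin.last d)`.
  have hN : (Matrix.of fun i j : Fin d => u i.castSucc j - u (Fin.last d) j)
      = (1 + Matrix.replicateCol Unit (fun _ : Fin d => (1 : ℝ)) * Matrix.replicateRow Unit
        (fun i : Fin d => k (Fin.last d) * (k i.castSucc)⁻¹)) * vertexMatrix u := by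
    rw [add_mul, one_mul, Matrix.mul_assoc]
    ext i j
    have := congrFun hu j
    simp at this
    simp [Matrix.mul_apply, vertexMatrix, mul_assoc, ← Finset.mul_sum]
    field_simp at this ⊢
    linarith
  rw [hN, Matrix.det_mul, Matrix.det_one_add_replicateCol_mul_replicateRow, abs_mul]
  congr 1
  simp only [dotProduct, mul_one, ← Finset.mul_sum]
  rw [eq_sub_of_add_eq hsum, mul_sub, mul_inv_cancel₀ hl, mul_one, add_sub_cancel, abs_of_pos (hk _)]

/-- Another rank-one update, with factor `1 - ∑ 1 / k i` over `i < d`, which is the reciprocal of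
the last `k`. The matrix is the pairing matrix of the first `d` vertices of a simplex and its dual.
-/
theorem det_diagonal_sub_one {d : ℕ} {k : Fin (d + 1) → ℝ} (hk : ∀ i, 0 < k i)
    (hsum : ∑ i, (k i)⁻¹ = 1) :
    (Matrix.of fun i j : Fin d => (if i = j then k i.castSucc else 0) - 1).det
        * k (Fin.last d) = ∏ i : Fin d, k i.castSucc := by
  have hk' : ∀ i, k i ≠ 0 := fun i => (hk i).ne'
  rw [Fin.sum_univ_castSucc] at hsum
  have hN : (Matrix.of fun i j : Fin d => (if i = j then k i.castSucc else 0) - 1)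
      = Matrix.diagonal (fun i : Fin d => k i.castSucc) *
        (1 + Matrix.replicateCol Unit (fun i : Fin d => (k i.castSucc)⁻¹) *
          Matrix.replicateRow Unit (fun _ : Fin d => (-1 : ℝ))) := by
    rw [mul_add, mul_one]
    ext i j
    simp [Matrix.mul_apply, Matrix.diagonal_apply, hk', sub_eq_add_neg]
  rw [hN, Matrix.det_mul, Matrix.det_one_add_replicateCol_mul_replicateRow, Matrix.det_diagonal]
  simp only [dotProduct, neg_one_mul, Finset.sum_neg_distrib]
  rw [eq_sub_of_add_eq hsum]
  have := hk' (Fin.last d)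
  field_simp
  ring

/-! ### Barycentric weights and dual pairs of simplices -/

theorem weights_unique {ι E : Type*} [Fintype ι] [AddCommGroup E] [Module ℝ E] {u : ι → E}
    (hu : AffineIndependent ℝ u) {μ ν : ι → ℝ} (hs : ∑ i, μ i = ∑ i, ν i)
    (h : ∑ i, μ i • u i = ∑ i, ν i • u i) (i : ι) : μ i = ν i := by
  have := (affineIndependent_iff.mp hu) Finset.univ (fun i => μ i - ν i)
    (by simp [Finset.sum_sub_distrib, hs]) (by simp [sub_smul, Finset.sum_sub_distrib, h]) i
    (Finset.mem_univ i)
  linarith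

theorem extremePoints_convexHull_range {ι E : Type*} [Fintype ι] [AddCommGroup E] [Module ℝ E]
    {u : ι → E} (hu : AffineIndependent ℝ u) :
    (convexHull ℝ (Set.range u)).extremePoints ℝ = Set.range u := by
  classical
  refine Set.Subset.antisymm extremePoints_convexHull_subset ?_
  rintro _ ⟨j, rfl⟩
  rw [mem_extremePoints_iff_left]
  refine ⟨subset_convexHull ℝ _ ⟨j, rfl⟩, ?_⟩
  rintro x hx y hy ⟨a, b, ha, hb, hab, h⟩
  obtain ⟨μ, μ0, μ1, rfl⟩ := mem_convexHull_range_iff.mp hx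
  obtain ⟨ν, ν0, ν1, rfl⟩ := mem_convexHull_range_iff.mp hy
  have key := weights_unique hu (μ := fun i => a * μ i + b * ν i) (ν := Pi.single j 1)
    (by rw [Finset.sum_add_distrib, ← Finset.mul_sum, ← Finset.mul_sum, μ1, ν1]; simpa using hab)
    (by
      simp only [add_smul, mul_smul, Finset.sum_add_distrib, ← Finset.smul_sum, h]
      simp [Pi.single_apply, ite_smul])
  have hμ : ∀ i, i ≠ j → μ i = 0 := by
    intro i hi
    have h1 := key i
    rw [Pi.single_eq_of_ne hi] at h1
    have h2 := mul_nonneg ha.le (μ0 i)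
    have h3 := mul_nonneg hb.le (ν0 i)
    have h4 : a * μ i = 0 := by linarith
    exact (mul_eq_zero.mp h4).resolve_left ha.ne'
  rw [Fintype.sum_eq_single j hμ] at μ1
  rw [Fintype.sum_eq_single j fun i hi => by rw [hμ i hi, zero_smul], μ1, one_smul]

/-- `v` and `w` are the vertices of a simplex and of its dual; `(c i)⁻¹` are the barycentric
coordinates of the origin in both of them. -/
structure IsDualSimplexPair {d : ℕ} (v w : Fin (d + 1) → Fin d → ℝ) (c : Fin (d + 1) → ℝ) :
    Prop where
  pos : ∀ i, 0 < c i
  sum_inv : ∑ i, (c i)⁻¹ = 1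
  sum_left : ∑ i, (c i)⁻¹ • v i = 0
  sum_right : ∑ i, (c i)⁻¹ • w i = 0
  pairing : ∀ i j, v i ⬝ᵥ w j = (if i = j then c i else 0) - 1

namespace IsDualSimplexPair

variable {d : ℕ} {v w : Fin (d + 1) → Fin d → ℝ} {c : Fin (d + 1) → ℝ}

theorem symm (h : IsDualSimplexPair v w c) : IsDualSimplexPair w v c where
  pos := h.pos
  sum_inv := h.sum_inv
  sum_left := h.sum_right
  sum_right := h.sum_left
  pairing i j := by
    rw [dotProduct_comm, h.pairing]
    by_cases hij : i = j
    · simp [hij]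
    · simp [hij, Ne.symm hij]

theorem comp_perm (h : IsDualSimplexPair v w c) (σ : Equiv.Perm (Fin (d + 1))) :
    IsDualSimplexPair (v ∘ σ) (w ∘ σ) (c ∘ σ) where
  pos i := h.pos _
  sum_inv := (Equiv.sum_comp σ fun i => (c i)⁻¹).trans h.sum_inv
  sum_left := (Equiv.sum_comp σ fun i => (c i)⁻¹ • v i).trans h.sum_left
  sum_right := (Equiv.sum_comp σ fun i => (c i)⁻¹ • w i).trans h.sum_right
  pairing i j := by simp [h.pairing]

/-- Pairing with `w j` reads off the weight at `v j`; this is how weights are recovered from points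
below. -/
theorem sum_smul_dotProduct (h : IsDualSimplexPair v w c) (μ : Fin (d + 1) → ℝ)
    (j : Fin (d + 1)) : (∑ i, μ i • v i) ⬝ᵥ w j = μ j * c j - ∑ i, μ i := by
  simp [sum_dotProduct, h.pairing, mul_sub, Finset.sum_sub_distrib]

theorem affineIndependent (h : IsDualSimplexPair v w c) : AffineIndependent ℝ v := by
  rw [affineIndependent_iff_of_fintype]
  intro μ h0 h1 j
  rw [Finset.weightedVSub_eq_linear_combination _ h0] at h1
  have := h.sum_smul_dotProduct μ j
  rw [h1, h0, zero_dotProduct, sub_zero] at this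
  exact (mul_eq_zero.mp this.symm).resolve_right (h.pos j).ne'

theorem det_mul_det (h : IsDualSimplexPair v w c) :
    (vertexMatrix v).det * (vertexMatrix w).det * c (Fin.last d)
      = ∏ i : Fin d, c i.castSucc := by
  rw [← det_diagonal_sub_one h.pos h.sum_inv, ← Matrix.det_transpose (vertexMatrix w),
    ← Matrix.det_mul]
  congr 2
  ext i j
  have := h.pairing i.castSucc j.castSucc
  simp only [Fin.castSucc_inj] at this
  exact this

theorem det_ne_zero (h : IsDualSimplexPair v w c) : (vertexMatrix v).det ≠ 0 := by
  intro h0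
  have := h.det_mul_det
  rw [h0, zero_mul, zero_mul] at this
  exact (Finset.prod_pos fun (i : Fin d) _ => h.pos i.castSucc).ne this

theorem normalizedVol_left (h : IsDualSimplexPair v w c) :
    normalizedVol (convexHull ℝ (Set.range v)) = c (Fin.last d) * |(vertexMatrix v).det| :=
  normalizedVol_eq_mul_abs_det h.pos h.sum_inv h.sum_left

theorem normalizedVol_mul (h : IsDualSimplexPair v w c) :
    normalizedVol (convexHull ℝ (Set.range v)) * normalizedVol (convexHull ℝ (Set.range w))
      = ∏ i, c i := by
  rw [h.normalizedVol_left, h.symm.normalizedVol_left, Fin.prod_univ_castSucc, ← h.det_mul_det]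
  have h1 : 0 < (vertexMatrix v).det * (vertexMatrix w).det := by
    have h2 := Finset.prod_pos fun (i : Fin d) (_ : i ∈ Finset.univ) => h.pos i.castSucc
    rw [← h.det_mul_det] at h2
    exact pos_of_mul_pos_left h2 (h.pos _).le
  rw [mul_mul_mul_comm, ← abs_mul, abs_of_pos h1]
  ring

theorem polytopeDual_eq (h : IsDualSimplexPair v w c) :
    polytopeDual (convexHull ℝ (Set.range v)) = convexHull ℝ (Set.range w) := by
  ext x
  rw [mem_convexHull_range_iff]
  constructor
  · intro hx
    have hx' : ∀ i, -1 ≤ v i ⬝ᵥ x := fun i => hx _ (subset_convexHull ℝ _ ⟨i, rfl⟩)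
    have hsum : ∑ i, (c i)⁻¹ * (1 + v i ⬝ᵥ x) = 1 := by
      have := congrArg (· ⬝ᵥ x) h.sum_left
      simp only [sum_dotProduct, smul_dotProduct, zero_dotProduct, smul_eq_mul] at this
      simp only [mul_add, mul_one, Finset.sum_add_distrib, h.sum_inv, this, add_zero]
    -- These weights are forced by `sum_smul_dotProduct`; the resulting point equals `x` because
    -- both pair equally with the first `d` vertices, which are independent.
    refine ⟨fun i => (c i)⁻¹ * (1 + v i ⬝ᵥ x),
      fun i => mul_nonneg (inv_nonneg.mpr (h.pos i).le) (by linarith [hx' i]), hsum, ?_⟩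
    refine sub_eq_zero.mp (Matrix.eq_zero_of_mulVec_eq_zero h.det_ne_zero ?_)
    ext i
    have h1 := h.symm.sum_smul_dotProduct (fun i => (c i)⁻¹ * (1 + v i ⬝ᵥ x)) i.castSucc
    rw [hsum, mul_right_comm, inv_mul_cancel₀ (h.pos _).ne', dotProduct_comm] at h1
    change v i.castSucc ⬝ᵥ _ = 0
    rw [dotProduct_sub, h1]
    ring
  · rintro ⟨μ, μ0, μ1, rfl⟩ y hy
    obtain ⟨ν, ν0, ν1, rfl⟩ := mem_convexHull_range_iff.mp hy
    have h1 : ∀ i, v i ⬝ᵥ ∑ j, μ j • w j = μ i * c i - 1 := fun i => by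
      rw [dotProduct_comm, h.symm.sum_smul_dotProduct, μ1]
    simp only [sum_dotProduct, smul_dotProduct, h1, smul_eq_mul, mul_sub, mul_one,
      Finset.sum_sub_distrib, ν1]
    have : 0 ≤ ∑ i, ν i * (μ i * c i) :=
      Finset.sum_nonneg fun i _ => mul_nonneg (ν0 i) (mul_nonneg (μ0 i) (h.pos i).le)
    linarith

end IsDualSimplexPair

/-- The dual vertex `w j` is the gradient of the `j`-th barycentric coordinate divided by its value
at 0, which is positive since 0 is interior; `c j` is the inverse of that value. -/
theorem exists_isDualSimplexPair {d : ℕ} {v : Fin (d + 1) → Fin d → ℝ}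
    (hv : AffineIndependent ℝ v) (h0 : 0 ∈ interior (convexHull ℝ (Set.range v))) :
    ∃ w c, IsDualSimplexPair v w c := by
  let b : AffineBasis (Fin (d + 1)) ℝ (Fin d → ℝ) :=
    ⟨v, hv, hv.affineSpan_eq_top_iff_card_eq_finrank_add_one.mpr (by simp)⟩
  have hb : ∀ i, b i = v i := fun _ => rfl
  have hpos : ∀ i, 0 < b.coord i 0 := by
    have := b.interior_convexHull
    rw [show Set.range b = Set.range v from rfl] at this
    rw [this] at h0
    exact h0
  have hlin : ∀ j x, (b.coord j).linear x = b.coord j x - b.coord j 0 := fun j x => by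
    rw [AffineMap.decomp' (b.coord j)]
    simp
  refine ⟨fun j i => (b.coord j 0)⁻¹ * (b.coord j).linear (Pi.single i 1),
    fun j => (b.coord j 0)⁻¹, fun i => inv_pos.mpr (hpos i), ?_, ?_, ?_, ?_⟩
  · simp only [inv_inv]
    exact b.sum_coord_apply_eq_one 0
  · simp only [inv_inv]
    exact b.linear_combination_coord_eq_self 0
  · ext i
    have h1 : ∀ j, b.coord j 0 * ((b.coord j 0)⁻¹ * (b.coord j).linear (Pi.single i 1))
        = b.coord j (Pi.single i 1) - b.coord j 0 := fun j => by
      rw [← hlin, mul_inv_cancel_left₀ (hpos j).ne']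
    simp only [inv_inv, Finset.sum_apply, Pi.smul_apply, smul_eq_mul, h1,
      Finset.sum_sub_distrib, b.sum_coord_apply_eq_one, sub_self, Pi.zero_apply]
  · intro i j
    have h1 : v i ⬝ᵥ (fun l => (b.coord j 0)⁻¹ * (b.coord j).linear (Pi.single l 1))
        = (b.coord j 0)⁻¹ * (b.coord j).linear (v i) := by
      conv_rhs => rw [LinearMap.pi_apply_eq_sum_univ (b.coord j).linear (v i)]
      rw [dotProduct, Finset.mul_sum]
      refine Finset.sum_congr rfl fun l _ => ?_
      have : (Pi.single l 1 : Fin d → ℝ) = fun m => if l = m then 1 else 0 := by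
        ext m; simp [Pi.single_apply, eq_comm]
      rw [this, smul_eq_mul]
      ring
    have h2 := (hpos j).ne'
    rw [h1, hlin, ← hb i, b.coord_apply]
    by_cases hij : i = j
    · subst hij; simp; field_simp
    · simp [hij, Ne.symm hij, h2]

/-! ### Integrality and lattice maps between simplices -/

theorem exists_int_dotProduct {d : ℕ} {x y : Fin d → ℝ} (hx : x ∈ intLattice d)
    (hy : y ∈ intLattice d) : ∃ n : ℤ, x ⬝ᵥ y = n := by
  choose a ha using hx
  choose b hb using hy
  exact ⟨∑ i, a i * b i, by simp [dotProduct, ha, hb]⟩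

/-- The dual vertices of a reflexive simplex; the barycentric coordinates of the origin are unit
fractions. -/
theorem exists_isDualSimplexPair_of_reflexive {d : ℕ} {v : Fin (d + 1) → Fin d → ℝ}
    (hv : AffineIndependent ℝ v) (hrefl : IsReflexivePolytope (convexHull ℝ (Set.range v))) :
    ∃ (w : Fin (d + 1) → Fin d → ℝ) (k : Fin (d + 1) → ℕ),
      IsDualSimplexPair v w (fun i => (k i : ℝ)) ∧ (∀ i, v i ∈ intLattice d) ∧
        ∀ i, w i ∈ intLattice d := by
  obtain ⟨⟨-, hP⟩, h0, ⟨-, hQ⟩⟩ := hrefl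
  obtain ⟨w, c, h⟩ := exists_isDualSimplexPair hv h0
  rw [h.polytopeDual_eq, extremePoints_convexHull_range h.symm.affineIndependent] at hQ
  rw [extremePoints_convexHull_range hv] at hP
  have hvl : ∀ i, v i ∈ intLattice d := fun i => hP ⟨i, rfl⟩
  have hwl : ∀ i, w i ∈ intLattice d := fun i => hQ ⟨i, rfl⟩
  have hc : ∀ i, ∃ n : ℕ, c i = n := by
    intro i
    obtain ⟨z, hz⟩ := exists_int_dotProduct (hvl i) (hwl i)
    rw [h.pairing, if_pos rfl] at hz
    have h1 : c i = ((z + 1 : ℤ) : ℝ) := by push_cast; linarith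
    have h2 : 0 < z + 1 := by
      have := h.pos i
      rw [h1] at this
      exact_mod_cast this
    refine ⟨(z + 1).toNat, ?_⟩
    rw [h1]
    exact_mod_cast (Int.toNat_of_nonneg h2.le).symm
  choose k hk using hc
  obtain rfl : c = fun i => (k i : ℝ) := funext hk
  exact ⟨w, k, h, hvl, hwl⟩

theorem exists_int_vertexMatrix {d : ℕ} {v : Fin (d + 1) → Fin d → ℝ}
    (hv : ∀ i, v i ∈ intLattice d) :
    ∃ V : Matrix (Fin d) (Fin d) ℤ, vertexMatrix v = V.map (Int.castRingHom ℝ) := by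
  choose V hV using hv
  exact ⟨Matrix.of fun i => V i.castSucc, by ext i j; simp [vertexMatrix, hV]⟩

theorem exists_int_det_vertexMatrix {d : ℕ} {v : Fin (d + 1) → Fin d → ℝ}
    (hv : ∀ i, v i ∈ intLattice d) : ∃ n : ℤ, (vertexMatrix v).det = n := by
  obtain ⟨V, hV⟩ := exists_int_vertexMatrix hv
  exact ⟨V.det, by rw [hV]; exact (RingHom.map_det (Int.castRingHom ℝ) V).symm⟩

/-- A linear map that carries the first `d` vertices of `u` to those of `v` carries the last one
as well, if the origin has the same barycentric coordinates. -/
theorem map_vertices {d : ℕ} {u v : Fin (d + 1) → Fin d → ℝ} {c : Fin (d + 1) → ℝ}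
    (hc : ∀ i, 0 < c i) (hu : ∑ i, (c i)⁻¹ • u i = 0) (hv : ∑ i, (c i)⁻¹ • v i = 0)
    (f : (Fin d → ℝ) →ₗ[ℝ] (Fin d → ℝ)) (hf : ∀ i : Fin d, f (u i.castSucc) = v i.castSucc)
    (i : Fin (d + 1)) : f (u i) = v i := by
  induction i using Fin.lastCases with
  | cast i => exact hf i
  | last =>
    have h1 := congrArg f hu
    rw [map_sum, map_zero, ← hv, Fin.sum_univ_castSucc, Fin.sum_univ_castSucc] at h1
    simp only [map_smul, hf, add_right_inj] at h1
    exact smul_right_injective _ (inv_ne_zero (hc _).ne') h1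

theorem vecMul_mem_intLattice {d : ℕ} {x : Fin d → ℝ} (hx : x ∈ intLattice d)
    (T : Matrix (Fin d) (Fin d) ℤ) :
    Matrix.vecMul x (T.map (Int.castRingHom ℝ)) ∈ intLattice d := by
  choose a ha using hx
  exact fun j => ⟨∑ i, a i * T i j, by simp [Matrix.vecMul, dotProduct, ha]⟩

theorem vertexMatrix_row {d : ℕ} (u : Fin (d + 1) → Fin d → ℝ) (i : Fin d) :
    u i.castSucc = Matrix.vecMul (Pi.single i 1) (vertexMatrix u) := by
  rw [Matrix.single_one_vecMul]; rfl

/-- Two lattice simplices for which the origin has the same barycentric coordinates and whose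
first `d` vertices form a lattice basis are unimodularly equivalent. -/
theorem unimodularEquiv_of_abs_det_eq_one {d : ℕ} {u v : Fin (d + 1) → Fin d → ℝ}
    {c : Fin (d + 1) → ℝ} (hc : ∀ i, 0 < c i)
    (hu : ∑ i, (c i)⁻¹ • u i = 0) (hv : ∑ i, (c i)⁻¹ • v i = 0)
    (hul : ∀ i, u i ∈ intLattice d) (hvl : ∀ i, v i ∈ intLattice d)
    (hud : |(vertexMatrix u).det| = 1) (hvd : |(vertexMatrix v).det| = 1) :
    UnimodularEquiv (convexHull ℝ (Set.range u)) (convexHull ℝ (Set.range v)) := by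
  obtain ⟨U, hU⟩ := exists_int_vertexMatrix hul
  obtain ⟨V, hV⟩ := exists_int_vertexMatrix hvl
  have hunit : ∀ (X : Matrix (Fin d) (Fin d) ℤ),
      |(X.map (Int.castRingHom ℝ)).det| = 1 → IsUnit X.det := by
    intro X hX
    have h1 := RingHom.map_det (Int.castRingHom ℝ) X
    rw [RingHom.mapMatrix_apply] at h1
    rw [← h1, eq_intCast] at hX
    rw [Int.isUnit_iff_abs_eq]
    exact_mod_cast hX
  have hUu := hunit U (hU ▸ hud)
  have hVu := hunit V (hV ▸ hvd)
  -- The inverses are taken over `ℤ`, so the base change and its inverse are both integral.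
  have hTT : (U⁻¹ * V) * (V⁻¹ * U) = 1 := by
    rw [Matrix.mul_assoc, Matrix.mul_nonsing_inv_cancel_left _ _ hVu,
      Matrix.nonsing_inv_mul _ hUu]
  have hTT' : (V⁻¹ * U) * (U⁻¹ * V) = 1 := by
    rw [Matrix.mul_assoc, Matrix.mul_nonsing_inv_cancel_left _ _ hUu,
      Matrix.nonsing_inv_mul _ hVu]
  have hUT : U * (U⁻¹ * V) = V := Matrix.mul_nonsing_inv_cancel_left _ _ hUu
  generalize U⁻¹ * V = T at hTT hTT' hUT
  generalize V⁻¹ * U = T' at hTT hTT'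
  let φ : (Fin d → ℝ) ≃ₗ[ℝ] (Fin d → ℝ) := LinearEquiv.ofLinearMap
    (Matrix.vecMulLinear (T.map (Int.castRingHom ℝ)))
    (Matrix.vecMulLinear (T'.map (Int.castRingHom ℝ)))
    (by
      refine LinearMap.ext fun x => ?_
      simp only [LinearMap.comp_apply, Matrix.vecMulLinear_apply, Matrix.vecMul_vecMul,
        ← Matrix.map_mul, hTT']
      simp)
    (by
      refine LinearMap.ext fun x => ?_
      simp only [LinearMap.comp_apply, Matrix.vecMulLinear_apply, Matrix.vecMul_vecMul,
        ← Matrix.map_mul, hTT]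
      simp)
  have hφu : ∀ i, φ (u i) = v i := by
    refine map_vertices hc hu hv φ.toLinearMap fun i => ?_
    change Matrix.vecMul (u i.castSucc) _ = _
    rw [vertexMatrix_row u, vertexMatrix_row v, Matrix.vecMul_vecMul, hU, hV, ← Matrix.map_mul,
      hUT]
  refine ⟨φ.toAffineEquiv, ?_, ?_⟩
  · apply Set.Subset.antisymm
    · rintro _ ⟨x, hx, rfl⟩
      exact vecMul_mem_intLattice hx T
    · intro x hx
      exact ⟨φ.symm x, vecMul_mem_intLattice hx T', φ.apply_symm_apply x⟩
  · change φ.toLinearMap '' _ = _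
    rw [LinearMap.image_convexHull, ← Set.range_comp]
    congr 2
    exact funext hφu

theorem UnimodularEquiv.symm {d : ℕ} {P Q : Set (Fin d → ℝ)} (h : UnimodularEquiv P Q) :
    UnimodularEquiv Q P := by
  obtain ⟨φ, h1, rfl⟩ := h
  refine ⟨φ.symm, ?_, ?_⟩
  · conv_lhs => rw [← h1]
    rw [← Set.image_comp]
    simp
  · rw [← Set.image_comp]
    simp

/-- If the vertices of a simplex generate the lattice, its volume is at most that of any lattice
simplex for which the origin has the same barycentric coordinates. -/
theorem abs_det_vertexMatrix_le_of_closure_eq {d : ℕ} {u v : Fin (d + 1) → Fin d → ℝ}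
    {c : Fin (d + 1) → ℝ} (hc : ∀ i, 0 < c i)
    (hu : ∑ i, (c i)⁻¹ • u i = 0) (hv : ∑ i, (c i)⁻¹ • v i = 0)
    (hvl : ∀ i, v i ∈ intLattice d)
    (hud : (vertexMatrix u).det ≠ 0) (hvd : (vertexMatrix v).det ≠ 0)
    (hgen : AddSubgroup.closure (Set.range u) = intLattice d) :
    |(vertexMatrix u).det| ≤ |(vertexMatrix v).det| := by
  have hUT : vertexMatrix u * ((vertexMatrix u)⁻¹ * vertexMatrix v) = vertexMatrix v :=
    Matrix.mul_nonsing_inv_cancel_left _ _ (isUnit_iff_ne_zero.mpr hud)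
  generalize (vertexMatrix u)⁻¹ * vertexMatrix v = T at hUT
  have hT : ∀ i, Matrix.vecMulLinear T (u i) = v i := by
    refine map_vertices hc hu hv _ fun i => ?_
    rw [Matrix.vecMulLinear_apply, vertexMatrix_row u, vertexMatrix_row v, Matrix.vecMul_vecMul,
      hUT]
  -- Generation makes `T` map the whole lattice into itself, so `T` is integral and its nonzero
  -- determinant has absolute value at least 1.
  have hmap : ∀ x ∈ AddSubgroup.closure (Set.range u), Matrix.vecMulLinear T x ∈ intLattice d := by
    intro x hx
    induction hx using AddSubgroup.closure_induction with
    | mem x hx => obtain ⟨i, rfl⟩ := hx; rw [hT]; exact hvl i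
    | zero => rw [map_zero]; exact zero_mem _
    | add x y _ _ hx hy => rw [map_add]; exact add_mem hx hy
    | neg x _ hx => rw [map_neg]; exact neg_mem hx
  rw [hgen] at hmap
  have hrow : ∀ i j, ∃ n : ℤ, T i j = n := by
    intro i j
    obtain ⟨n, hn⟩ := hmap (Pi.single i 1) (fun l => ⟨if l = i then 1 else 0, by
      simp [Pi.single_apply]⟩) j
    refine ⟨n, ?_⟩
    rw [← hn, Matrix.vecMulLinear_apply, Matrix.single_one_vecMul]
    rfl
  choose Z hZ using hrow
  have hTZ : T = (Matrix.of Z).map (Int.castRingHom ℝ) := by ext i j; simp [hZ]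
  have hdet : T.det = ((Matrix.of Z).det : ℝ) := by
    rw [hTZ]; exact (RingHom.map_det (Int.castRingHom ℝ) (Matrix.of Z)).symm
  have hprod := congrArg Matrix.det hUT
  rw [Matrix.det_mul, hdet] at hprod
  have hne : (Matrix.of Z).det ≠ 0 := by
    intro h0
    rw [h0] at hprod
    simp at hprod
    exact hvd hprod.symm
  have h1 : (1 : ℝ) ≤ |((Matrix.of Z).det : ℝ)| := by exact_mod_cast Int.one_le_abs hne
  rw [← hprod, abs_mul]
  exact le_mul_of_one_le_right (abs_nonneg _) h1

/-! ### The Sylvester simplex and the equality case -/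

/-- The vertices of `S_{Q_d}`. -/
noncomputable def sylvesterVertex (d : ℕ) (i : Fin (d + 1)) (j : Fin d) : ℝ :=
  (if i = j.castSucc then (sylvesterPartition d i : ℝ) else 0) - 1

theorem sum_sylvesterWeights (d : ℕ) : ∑ l, sylvesterWeights d l = sylvesterT d := by
  have hT : (sylvesterT d : ℝ) ≠ 0 := by exact_mod_cast (sylvesterT_pos d).ne'
  have h : ((∑ l, sylvesterWeights d l : ℕ) : ℝ) = sylvesterT d := by
    rw [Fin.sum_univ_castSucc]
    simp only [sylvesterWeights, Fin.snoc_castSucc, Fin.snoc_last]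
    push_cast [Nat.cast_div (sylvesterY_dvd_sylvesterT (Fin.is_lt _))
      (show ((sylvesterY _ : ℕ) : ℝ) ≠ 0 by exact_mod_cast (sylvesterY_pos _).ne')]
    simp only [div_eq_mul_inv, ← Finset.mul_sum]
    rw [Fin.sum_univ_eq_sum_range (fun i => (sylvesterY i : ℝ)⁻¹), sum_inv_sylvesterY]
    field_simp
    ring
  exact_mod_cast h

theorem weightSimplex_sylvesterWeights (d : ℕ) :
    weightSimplex (sylvesterWeights d) = convexHull ℝ (Set.range (sylvesterVertex d)) := by
  have hT : (sylvesterT d : ℝ) ≠ 0 := by exact_mod_cast (sylvesterT_pos d).ne'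
  rw [weightSimplex, sum_sylvesterWeights]
  congr 1
  have hcast : ∀ i : Fin d, sylvesterVertex d i.castSucc = fun j =>
      (if j = i then (sylvesterT d : ℝ) / (sylvesterWeights d i.castSucc : ℝ) else 0) - 1 := by
    intro i
    have hY : (sylvesterY i : ℝ) ≠ 0 := by exact_mod_cast (sylvesterY_pos i).ne'
    funext j
    simp only [sylvesterVertex, Fin.castSucc_inj, sylvesterPartition_castSucc, sylvesterWeights,
      Fin.snoc_castSucc, eq_comm (a := i)]
    rw [Nat.cast_div (sylvesterY_dvd_sylvesterT i.isLt) hY, div_div_cancel₀ hT]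
  have hlast : sylvesterVertex d (Fin.last d) = fun _ => -1 := by
    funext j
    simp [sylvesterVertex, (Fin.castSucc_lt_last j).ne']
  ext x
  simp only [Set.mem_insert_iff, Set.mem_range, ← hcast, ← hlast, Fin.exists_fin_succ']
  rw [or_comm, eq_comm]

theorem sylvesterVertex_mem_intLattice {d : ℕ} (i : Fin (d + 1)) :
    sylvesterVertex d i ∈ intLattice d := fun j =>
  ⟨(if i = j.castSucc then (sylvesterPartition d i : ℤ) else 0) - 1, by
    rw [sylvesterVertex]; push_cast; rfl⟩

theorem sum_smul_sylvesterVertex (d : ℕ) :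
    ∑ i, (sylvesterPartition d i : ℝ)⁻¹ • sylvesterVertex d i = 0 := by
  ext j
  have h : (sylvesterPartition d j.castSucc : ℝ) ≠ 0 := by
    exact_mod_cast (sylvesterPartition_pos _).ne'
  simp only [Finset.sum_apply, Pi.smul_apply, sylvesterVertex, smul_eq_mul, mul_sub, mul_ite,
    mul_zero, mul_one, Finset.sum_sub_distrib, sum_inv_sylvesterPartition, Finset.sum_ite_eq',
    Finset.mem_univ, if_true, inv_mul_cancel₀ h, sub_self, Pi.zero_apply]

/-- The determinant is `y_0 ⋯ y_{d-1} / t_d`. -/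
theorem det_sylvesterVertex (d : ℕ) : (vertexMatrix (sylvesterVertex d)).det = 1 := by
  have h := det_diagonal_sub_one (k := fun i => (sylvesterPartition d i : ℝ))
    (fun i => by exact_mod_cast sylvesterPartition_pos i) (sum_inv_sylvesterPartition d)
  have hT : (sylvesterT d : ℝ) ≠ 0 := by exact_mod_cast (sylvesterT_pos d).ne'
  rw [prod_sylvesterPartition_castSucc, sylvesterPartition_last] at h
  have h2 : vertexMatrix (sylvesterVertex d) = Matrix.of fun i j : Fin d =>
      (if i = j then (sylvesterPartition d i.castSucc : ℝ) else 0) - 1 := by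
    ext i j
    simp [vertexMatrix, sylvesterVertex]
  rw [h2]
  exact mul_right_cancel₀ hT (h.trans (one_mul _).symm)

/-- An affine equivalence onto `S_{Q_d}` that preserves the lattice matches the weights, since
the origin is the only interior lattice point of a reflexive polytope. -/
theorem prod_eq_of_unimodularEquiv {d : ℕ} {v w : Fin (d + 1) → Fin d → ℝ}
    {k : Fin (d + 1) → ℕ} (h : IsDualSimplexPair v w fun i => (k i : ℝ))
    (hw : ∀ i, w i ∈ intLattice d)
    (he : UnimodularEquiv (convexHull ℝ (Set.range v)) (weightSimplex (sylvesterWeights d))) :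
    ∏ i, k i = sylvesterT d ^ 2 := by
  obtain ⟨φ, hφl, hφ⟩ := he
  rw [weightSimplex_sylvesterWeights] at hφ
  have himage : φ '' convexHull ℝ (Set.range v) = convexHull ℝ (Set.range (φ ∘ v)) := by
    rw [Set.range_comp]
    exact AffineMap.image_convexHull φ.toAffineMap _
  have hind : AffineIndependent ℝ (φ ∘ v) :=
    h.affineIndependent.map' φ.toAffineMap φ.injective
  have hsub : Set.range (φ ∘ v) ⊆ Set.range (sylvesterVertex d) := by
    rw [← extremePoints_convexHull_range hind, ← himage, hφ]
    exact extremePoints_convexHull_subset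
  have hex : ∀ i, ∃ j, sylvesterVertex d j = φ (v i) := fun i => hsub ⟨i, rfl⟩
  choose σ hσ using hex
  have hσi : Function.Injective σ := fun i j hij =>
    hind.injective (by simp only [Function.comp_apply]; rw [← hσ, ← hσ, hij])
  let τ : Equiv.Perm (Fin (d + 1)) := Equiv.ofBijective σ (Finite.injective_iff_bijective.mp hσi)
  set μ : Fin (d + 1) → ℝ := fun i => (sylvesterPartition d (σ i) : ℝ)⁻¹ with hμ
  have hμ1 : ∑ i, μ i = 1 :=
    (Equiv.sum_comp τ fun i => (sylvesterPartition d i : ℝ)⁻¹).trans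
      (sum_inv_sylvesterPartition d)
  -- A priori `φ` need not fix 0, so its preimage of 0 is tracked through the transported weights
  -- `μ`.
  have hφμ : φ (∑ i, μ i • v i) = 0 := by
    have hdec : ∀ x, φ x = φ.linear x + φ 0 := fun x => by
      have := φ.map_vadd 0 x
      simpa using this
    rw [hdec, map_sum]
    calc ∑ i, φ.linear (μ i • v i) + φ 0 = ∑ i, μ i • φ (v i) := by
          simp_rw [hdec (v _), smul_add, Finset.sum_add_distrib, ← Finset.sum_smul, hμ1, map_smul,
            one_smul]
      _ = ∑ i, (sylvesterPartition d (τ i) : ℝ)⁻¹ • sylvesterVertex d (τ i) := by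
          simp_rw [← hσ]; rfl
      _ = 0 := (Equiv.sum_comp τ fun i => (sylvesterPartition d i : ℝ)⁻¹ •
          sylvesterVertex d i).trans (sum_smul_sylvesterVertex d)
  have hz : ∑ i, μ i • v i ∈ intLattice d := by
    have h0 : (0 : Fin d → ℝ) ∈ φ '' (intLattice d : Set (Fin d → ℝ)) := by
      rw [hφl]; exact zero_mem _
    obtain ⟨z, hz, hz0⟩ := h0
    rwa [φ.injective (hφμ.trans hz0.symm)]
  have hval : ∀ j, (∑ i, μ i • v i) ⬝ᵥ w j = μ j * k j - 1 := fun j => by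
    rw [h.sum_smul_dotProduct, hμ1]
  -- Each pairing with `w j` is an integer above `-1`, hence nonnegative; their weighted sum is 0,
  -- so all vanish and `k j = 1 / μ j`.
  have hnonneg : ∀ j ∈ Finset.univ, 0 ≤ (k j : ℝ)⁻¹ * (μ j * k j - 1) := by
    intro j _
    obtain ⟨n, hn⟩ := exists_int_dotProduct hz (hw j)
    rw [hval] at hn
    have h1 : 0 < μ j * k j :=
      mul_pos (inv_pos.mpr (by exact_mod_cast sylvesterPartition_pos _)) (h.pos j)
    have h2 : (-1 : ℝ) < n := by linarith
    have h3 : (0 : ℤ) ≤ n := by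
      have : (-1 : ℤ) < n := by exact_mod_cast h2
      omega
    rw [hn]
    exact mul_nonneg (inv_nonneg.mpr (h.pos j).le) (by exact_mod_cast h3)
  have hsum : ∑ j, (k j : ℝ)⁻¹ * (μ j * k j - 1) = 0 := by
    have := congrArg ((∑ i, μ i • v i) ⬝ᵥ ·) h.sum_right
    simpa only [dotProduct_sum, dotProduct_smul, hval, dotProduct_zero, smul_eq_mul] using this
  have hk : ∀ j, k j = sylvesterPartition d (τ j) := by
    intro j
    have h1 := (Finset.sum_eq_zero_iff_of_nonneg hnonneg).mp hsum j (Finset.mem_univ j)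
    have h2 := (mul_eq_zero.mp h1).resolve_left (inv_ne_zero (h.pos j).ne')
    have h3 : (sylvesterPartition d (σ j) : ℝ) ≠ 0 := by
      exact_mod_cast (sylvesterPartition_pos _).ne'
    simp only [hμ] at h2
    field_simp at h2
    have h4 : (k j : ℝ) = sylvesterPartition d (σ j) := by linarith
    exact_mod_cast h4
  rw [← prod_sylvesterPartition, Finset.prod_congr rfl fun j _ => hk j]
  exact Equiv.prod_comp τ _

/-- After sorting, `k` is the Sylvester partition, whose first `d` entries multiply to its last.
Hence `det_mul_det` makes the two integral determinants multiply to 1, and each is a unit. -/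
theorem unimodularEquiv_of_sylvesterT_sq_le {d : ℕ} {v w : Fin (d + 1) → Fin d → ℝ}
    {k : Fin (d + 1) → ℕ} (h : IsDualSimplexPair v w fun i => (k i : ℝ))
    (hv : ∀ i, v i ∈ intLattice d) (hw : ∀ i, w i ∈ intLattice d)
    (hprod : sylvesterT d ^ 2 ≤ ∏ i, k i) :
    UnimodularEquiv (convexHull ℝ (Set.range v)) (weightSimplex (sylvesterWeights d)) ∧
    UnimodularEquiv (convexHull ℝ (Set.range w)) (weightSimplex (sylvesterWeights d)) ∧
    UnimodularEquiv (convexHull ℝ (Set.range v)) (convexHull ℝ (Set.range w)) ∧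
    normalizedVol (convexHull ℝ (Set.range w)) = sylvesterT d := by
  obtain ⟨σ, hσ⟩ := exists_perm_eq_sylvesterPartition (fun i => by exact_mod_cast h.pos i)
    h.sum_inv hprod
  have h' := h.comp_perm σ
  rw [show (fun i => (k i : ℝ)) ∘ σ = fun i => (sylvesterPartition d i : ℝ) by
    rw [← hσ]; rfl] at h'
  rw [← σ.surjective.range_comp v, ← σ.surjective.range_comp w, weightSimplex_sylvesterWeights]
  have hv' : ∀ i, (v ∘ σ) i ∈ intLattice d := fun i => hv _
  have hw' : ∀ i, (w ∘ σ) i ∈ intLattice d := fun i => hw _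
  have hS : |(vertexMatrix (sylvesterVertex d)).det| = 1 := by rw [det_sylvesterVertex, abs_one]
  have hdet := h'.det_mul_det
  have hT : (sylvesterT d : ℝ) ≠ 0 := by exact_mod_cast (sylvesterT_pos d).ne'
  rw [prod_sylvesterPartition_castSucc, sylvesterPartition_last, mul_eq_right₀ hT] at hdet
  obtain ⟨a, ha⟩ := exists_int_det_vertexMatrix hv'
  obtain ⟨b, hb⟩ := exists_int_det_vertexMatrix hw'
  have hab : a * b = 1 := by
    rw [ha, hb] at hdet
    exact_mod_cast hdet
  have ha1 : |(vertexMatrix (v ∘ σ)).det| = 1 := by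
    rw [ha]
    exact_mod_cast Int.isUnit_iff_abs_eq.mp (IsUnit.of_mul_eq_one b hab)
  have hb1 : |(vertexMatrix (w ∘ σ)).det| = 1 := by
    rw [hb]
    exact_mod_cast Int.isUnit_iff_abs_eq.mp (IsUnit.of_mul_eq_one a ((mul_comm b a).trans hab))
  refine ⟨?_, ?_, ?_, ?_⟩
  · exact unimodularEquiv_of_abs_det_eq_one h'.pos h'.sum_left (sum_smul_sylvesterVertex d) hv'
      sylvesterVertex_mem_intLattice ha1 hS
  · exact unimodularEquiv_of_abs_det_eq_one h'.pos h'.sum_right (sum_smul_sylvesterVertex d) hw'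
      sylvesterVertex_mem_intLattice hb1 hS
  · exact unimodularEquiv_of_abs_det_eq_one h'.pos h'.sum_left h'.sum_right hv' hw' ha1 hb1
  · rw [h'.symm.normalizedVol_left, hb1, mul_one, sylvesterPartition_last]

/-! ### The main theorem -/

theorem theoremC {d : ℕ} (hd : 2 ≤ d)
    -- `P` is the `d`-dimensional simplex with the vertices `v 0, …, v d`
    (v : Fin (d + 1) → (Fin d → ℝ)) (hv : AffineIndependent ℝ v)
    (P : Set (Fin d → ℝ)) (hP : P = convexHull ℝ (Set.range v))
    (hrefl : IsReflexivePolytope P) :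
    ((d : ℝ) + 1) ^ (d + 1) ≤ normalizedVol P * normalizedVol (polytopeDual P) ∧
    normalizedVol P * normalizedVol (polytopeDual P) ≤ (sylvesterT d : ℝ) ^ 2 ∧
    (normalizedVol P * normalizedVol (polytopeDual P) = ((d : ℝ) + 1) ^ (d + 1) ↔
      ∑ i, v i = 0) ∧
    (normalizedVol P * normalizedVol (polytopeDual P) = (sylvesterT d : ℝ) ^ 2 ↔
      UnimodularEquiv P (weightSimplex (sylvesterWeights d))) ∧
    (UnimodularEquiv P (weightSimplex (sylvesterWeights d)) →
      UnimodularEquiv P (polytopeDual P)) ∧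
    (AddSubgroup.closure ((polytopeDual P).extremePoints ℝ) = intLattice d →
      normalizedVol (polytopeDual P) ≤ (sylvesterT d : ℝ) ∧
      (normalizedVol (polytopeDual P) = (sylvesterT d : ℝ) ↔
        (UnimodularEquiv (polytopeDual P) (weightSimplex (sylvesterWeights d)) ∧
          UnimodularEquiv (weightSimplex (sylvesterWeights d)) P))) := by
  subst hP
  obtain ⟨w, k, h, hvl, hwl⟩ := exists_isDualSimplexPair_of_reflexive hv hrefl
  have hk : ∀ i, 0 < k i := fun i => by exact_mod_cast h.pos i
  have hvol := h.normalizedVol_mul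
  rw [h.polytopeDual_eq, extremePoints_convexHull_range h.symm.affineIndependent, hvol]
  have hupper : ∏ i, (k i : ℝ) ≤ (sylvesterT d : ℝ) ^ 2 := by
    exact_mod_cast prod_le_sylvesterT_sq hk h.sum_inv
  have hlower := pow_le_prod_of_sum_inv_eq_one hk h.sum_inv
  have hequiv : (sylvesterT d : ℝ) ^ 2 ≤ ∏ i, (k i : ℝ) → _ := fun hle =>
    unimodularEquiv_of_sylvesterT_sq_le h hvl hwl (by exact_mod_cast hle)
  have hprod : UnimodularEquiv (convexHull ℝ (Set.range v)) (weightSimplex (sylvesterWeights d)) →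
      ∏ i, (k i : ℝ) = (sylvesterT d : ℝ) ^ 2 := fun he => by
    exact_mod_cast prod_eq_of_unimodularEquiv h hwl he
  refine ⟨hlower.1, hupper, ?_, ⟨fun he => (hequiv he.ge).1, hprod⟩,
    fun he => (hequiv (hprod he).ge).2.2.1, fun hgen => ?_⟩
  · have hd0 : (d : ℝ) + 1 ≠ 0 := by positivity
    rw [hlower.2]
    constructor
    · intro hc
      have := h.sum_left
      simp only [hc, ← Finset.smul_sum] at this
      exact (smul_eq_zero.mp this).resolve_left (inv_ne_zero hd0)
    · intro hs i
      -- If the vertices sum to 0, equal weights also represent the origin, and barycentric weights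
      -- are unique.
      refine inv_injective (weights_unique hv (μ := fun i => (k i : ℝ)⁻¹)
        (ν := fun _ => ((d : ℝ) + 1)⁻¹) ?_ ?_ i)
      · rw [h.sum_inv]
        simp [hd0]
      · rw [h.sum_left, ← Finset.smul_sum, hs, smul_zero]
  · have hle : normalizedVol (convexHull ℝ (Set.range w))
        ≤ normalizedVol (convexHull ℝ (Set.range v)) := by
      rw [h.normalizedVol_left, h.symm.normalizedVol_left]
      exact mul_le_mul_of_nonneg_left (abs_det_vertexMatrix_le_of_closure_eq h.pos h.sum_right
        h.sum_left hvl h.symm.det_ne_zero h.det_ne_zero hgen) (h.pos _).le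
    have hw0 : 0 ≤ normalizedVol (convexHull ℝ (Set.range w)) := by
      rw [h.symm.normalizedVol_left]
      exact mul_nonneg (h.pos _).le (abs_nonneg _)
    have hsq := mul_le_mul_of_nonneg_right hle hw0
    rw [hvol, ← sq] at hsq
    refine ⟨le_of_sq_le_sq (hsq.trans hupper) (Nat.cast_nonneg _), fun he => ?_, fun he => ?_⟩
    · rw [he] at hsq
      exact ⟨(hequiv hsq).2.1, (hequiv hsq).1.symm⟩
    · exact (hequiv (hprod he.2.symm).ge).2.2.2
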